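/- Let $n,N\ge 1$ and let $f(w)=\prod_{i=1}^{n+1}\frac{w-w_{a_i}}{w-w_{b_i}}$, where the zeros $w_{a_1},\dots,w_{a_{n+1}}$ are real and pairwise distinct, no zero equals a pole, and the poles $w_{b_i}\in\mathbb C$ are real or pairwise conjugate (with multiplicity). Let $\theta\in\mathbb R$, and let $d\in\mathbb C^{2N}$ satisfy $\overline{d_{2k-1}}=d_{2k}$ for $1\le k\le N$. Let $w_{u_k},w_{v_k}\in\mathbb C$ $(1\le k\le 2N)$ satisfy $$f(w_{u_k})=f(w_{v_k})\in\mathbb C\cup\{\infty\}\quad(1\le k\le 2N),$$ $$\overline{w_{u_{2k}}}=w_{v_{2k-1}},\qquad \overline{w_{u_{2k-1}}}=w_{v_{2k}}\quad(1\le k\le N),$$ and suppose that $w_{v_i}\ne w_{u_k}$ for all $i,k$ and that no $w_{u_k}$ or $w_{v_k}$ is a zero of $f$ (so that the quantities below are defined). Write $c=w_{a_{n+1}}$ and, for $1\le j\le n$ and $1\le k\le 2N$, put $$V_k=\frac1{f'(c)}\Big(\frac1{c-w_{v_k}}-\frac1{c-w_{u_k}}\Big),$$ $$W_k=\frac1{f'(c)^2}\Big(-\frac1{(c-w_{v_k})^2}+\frac1{(c-w_{u_k})^2}\Big)-\frac{f''(c)}{f'(c)^2}V_k,$$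 $$r_{j,k}=\ln\Big\{\frac{w_{a_j}-w_{v_k}}{w_{a_j}-w_{u_k}}\,\frac{c-w_{u_k}}{c-w_{v_k}}\Big\},\qquad q_j=\frac1{f'(c)\,f'(w_{a_j})\,(c-w_{a_j})^2},$$ $$E_j=\frac1{f'(c)(w_{a_j}-c)}-\frac{f''(c)}{2f'(c)^2},\qquad F_j=-E_j^2+2\sum_{k=1}^n q_k .$$ For $\beta\in\{0,1\}$ let $\mathbb T_{j,\beta}(x,t)$ be the $2N\times 2N$ matrix with entries $$(\mathbb T_{j,\beta})_{ik}=\delta_{ik}+\frac{w_{v_i}-w_{u_i}}{w_{v_i}-w_{u_k}}\,e^{\frac12(z_i+z_k)},\qquad z_k=\mathrm i V_kx+\mathrm i W_kt-d_k+\beta r_{j,k}$$ (the determinant does not depend on the branch of the logarithm). Put $s_j=\operatorname{sign}\big(f'(w_{a_{n+1}})f'(w_{a_j})\big)$. Then each $s_j$ is $1$ or $-1$, and the functions (called $N$-breather solutions) $$\psi_j(x,t)=|q_j|^{1/2}\,e^{\mathrm i\theta}\,\frac{\det\mathbb T_{j,1}(x,t)}{\det\mathbb T_{j,0}(x,t)}\,e^{\mathrm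 i(-E_jx+F_jt)},\qquad 1\le j\le n,$$ are, on the open set of $(x,t)\in\mathbb R^2$ where $\det\mathbb T_{j,0}(x,t)\neq0$ (the same for all $j$), smooth solutions of the $n$-component nonlinear Schrödinger equation n-NLS$^s$: $$\mathrm i\,\frac{\partial\psi_j}{\partial t}+\frac{\partial^2\psi_j}{\partial x^2}+2\Big(\sum_{k=1}^n s_k|\psi_k|^2\Big)\psi_j=0,\qquad j=1,\dots,n.$$ -/

import Mathlib

namespace NBreather

open Complex

noncomputable section

/-- `ψ = (ψ_1, …, ψ_n)` is a smooth solution, on the open set `Ω` of the `(x,t)`-plane, of the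
multi-component nonlinear Schrödinger equation n-NLS^s
`i ∂ψ_j/∂t + ∂²ψ_j/∂x² + 2 (∑_k s_k |ψ_k|²) ψ_j = 0`, `j = 1, …, n`, with all `s_k = ±1`. -/
structure IsNNLSSolutionOn {n : ℕ} (s : Fin n → ℝ) (Ω : Set (ℝ × ℝ))
    (ψ : Fin n → ℝ → ℝ → ℂ) : Prop where
  sign_eq : ∀ k, s k = 1 ∨ s k = -1
  isOpen : IsOpen Ω
  smooth : ∀ j, ContDiffOn ℝ (⊤ : ℕ∞) (fun p : ℝ × ℝ => ψ j p.1 p.2) Ω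
  equation : ∀ j, ∀ x t : ℝ, (x, t) ∈ Ω →
    I * deriv (fun τ => ψ j x τ) t + iteratedDeriv 2 (fun ξ => ψ j ξ t) x
      + 2 * (∑ k, (s k : ℂ) * ((‖ψ k x t‖ : ℂ)) ^ 2) * ψ j x t = 0

/-- `f(w) = ∏_i (w - w_{a_i}) / (w - w_{b_i})`, as a complex function (meaningful off the
poles). -/
def merFun {m : ℕ} (a b : Fin m → ℂ) (w : ℂ) : ℂ := ∏ i, (w - a i) / (w - b i)

open Classical in
/-- The value of the meromorphic function `f` in the Riemann sphere `ℂ ∪ {∞}`, when no `a_i`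
equals a `b_k`: it is `∞` exactly at the poles. -/
def sphereValue {m : ℕ} (a b : Fin m → ℂ) (w : ℂ) : OnePoint ℂ :=
  if ∃ i, w = b i then OnePoint.infty else ((merFun a b w : ℂ) : OnePoint ℂ)

/-- The local parameter `k_c(w) = f(w) - f(c)` near a regular point `c`. -/
def localParam {m : ℕ} (a b : Fin m → ℂ) (c w : ℂ) : ℂ := merFun a b w - merFun a b c

/-- `V_{c,k}`, for a local parameter `κ` at `c` and the points `w_{u_k}`, `w_{v_k}`. -/
def coefV (κ : ℂ → ℂ) (c wu wv : ℂ) : ℂ :=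
  1 / deriv κ c * (1 / (c - wv) - 1 / (c - wu))

/-- `W_{c,k}`. -/
def coefW (κ : ℂ → ℂ) (c wu wv : ℂ) : ℂ :=
  1 / (deriv κ c) ^ 2 * (-(1 / (c - wv) ^ 2) + 1 / (c - wu) ^ 2)
    - iteratedDeriv 2 κ c / (deriv κ c) ^ 2 * coefV κ c wu wv

/-- `r_k` for the points `c, e`. The branch of the logarithm is irrelevant in the determinants
below: another branch changes the sign of one row and of the same column off the diagonal. -/
def coefR (c e wu wv : ℂ) : ℂ :=
  Complex.log ((e - wv) / (e - wu) * ((c - wu) / (c - wv)))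

/-- `q_2(c,e)`, with local parameters `κ` at `c` and `κ'` at `e`. -/
def coefQ (κ κ' : ℂ → ℂ) (c e : ℂ) : ℂ := 1 / (deriv κ c * deriv κ' e * (c - e) ^ 2)

/-- `K_1(c,e)`, with local parameter `κ` at `c`. -/
def coefK (κ : ℂ → ℂ) (c e : ℂ) : ℂ :=
  1 / (deriv κ c * (e - c)) - 1 / 2 * (iteratedDeriv 2 κ c / (deriv κ c) ^ 2)

/-- The `g × g` matrix `δ_{ik} + (w_{v_i} - w_{u_i}) / (w_{v_i} - w_{u_k}) e^{(z_i + z_k)/2}`. -/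
def matT {g : ℕ} (u v z : Fin g → ℂ) : Matrix (Fin g) (Fin g) ℂ :=
  Matrix.of fun i k =>
    (if i = k then 1 else 0) + (v i - u i) / (v i - u k) * Complex.exp (1 / 2 * (z i + z k))

section Solution

/-! Here `a, b` list the zeros and poles of `f`; the zero `w_{a_{n+1}}` is `a (Fin.last n)`, and
`w_{a_j}`, `1 ≤ j ≤ n`, is `a j.castSucc`. -/

variable {n g : ℕ} (a b : Fin (n + 1) → ℂ) (u v d : Fin g → ℂ)

/-- `q_2(a_{n+1}, a_j)`. -/
def q2 (j : Fin n) : ℂ :=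
  coefQ (localParam a b (a (Fin.last n))) (localParam a b (a j.castSucc))
    (a (Fin.last n)) (a j.castSucc)

/-- `E_j = K_1(a_{n+1}, a_j)`. -/
def coefE (j : Fin n) : ℂ :=
  coefK (localParam a b (a (Fin.last n))) (a (Fin.last n)) (a j.castSucc)

/-- `F_j = -K_1(a_{n+1}, a_j)² + 2 ∑_k q_2(a_{n+1}, a_k)`. -/
def coefF (j : Fin n) : ℂ := -(coefE a b j) ^ 2 + 2 * ∑ k, q2 a b k

/-- `Z_k = i V_{a_{n+1},k} x + i W_{a_{n+1},k} t`. -/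
def phaseZ (x t : ℝ) (k : Fin g) : ℂ :=
  I * coefV (localParam a b (a (Fin.last n))) (a (Fin.last n)) (u k) (v k) * x
    + I * coefW (localParam a b (a (Fin.last n))) (a (Fin.last n)) (u k) (v k) * t

/-- The matrix `𝕋_{j,β}`, i.e. `matT` at `z_k = Z_k - d_k + β r_{j,k}`. -/
def matTj (j : Fin n) (β : ℂ) (x t : ℝ) : Matrix (Fin g) (Fin g) ℂ :=
  matT u v fun k => phaseZ a b u v x t k - d k
    + β * coefR (a (Fin.last n)) (a j.castSucc) (u k) (v k)

/-- `ψ_j(x,t) = A_j e^{iθ} det 𝕋_{j,1} / det 𝕋_{j,0} exp{i (-E_j x + F_j t)}` with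
`A_j = |q_2(a_{n+1}, a_j)|^{1/2}`. -/
def psi (θ : ℝ) (j : Fin n) (x t : ℝ) : ℂ :=
  (Real.sqrt ‖q2 a b j‖ : ℂ) * Complex.exp (I * θ)
    * ((matTj a b u v d j 1 x t).det / (matTj a b u v d j 0 x t).det)
    * Complex.exp (I * (-(coefE a b j) * x + coefF a b j * t))

/-- The set of `(x,t)` at which the denominators `det 𝕋_{j,0}` do not vanish (as a matrix,
`𝕋_{j,0}` is the same for all `j`). -/
def regularSet : Set (ℝ × ℝ) := {p | ∀ j : Fin n, (matTj a b u v d j 0 p.1 p.2).det ≠ 0}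

/-- `s_j = sign (f'(w_{a_{n+1}}) f'(w_{a_j}))`; the argument is a real number when `f` is a real
function with real zeros. -/
def signS (j : Fin n) : ℝ :=
  Real.sign (deriv (merFun a b) (a (Fin.last n)) * deriv (merFun a b) (a j.castSucc)).re

end Solution

/-- The index `2k-1`, `1 ≤ k ≤ N`, among `1, …, 2N` (both counted from `0` here). -/
def oddIdx {N : ℕ} (k : Fin N) : Fin (2 * N) := ⟨2 * k, by omega⟩

/-- The index `2k`, `1 ≤ k ≤ N`, among `1, …, 2N` (both counted from `0` here). -/
def evenIdx {N : ℕ} (k : Fin N) : Fin (2 * N) := ⟨2 * k + 1, by omega⟩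

end

end NBreather

/-! Write `c` for the last zero. The Möbius coordinate `K(w) = 1/(f'(c)(w-c)) - f''(c)/(2f'(c)²)`,
which is `coefK`, sends `c` to infinity. With `α_k = K(u_k)`, `β_k = K(v_k)`, `E_j = K(a_j)` one
gets `V_k = α_k - β_k`, `W_k = α_k² - β_k²` and `exp r_{j,k} = (β_k - E_j)/(α_k - E_j)`. A diagonal
conjugation turns the determinants into those of `1 + M`, with `M` the Cauchy-like matrix `cauchyM`.

Let `(1 + M) g = m`, where `m_i = (α_i - β_i) e_i`. The commutation rule `M diag(α) - diag(β) M = m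
⊗ 1` drives everything. It makes the shifted determinant ratios `φ_j` rational expressions in `g`
(`det_one_add_cauchyM_shift`), and it gives `g`, hence `φ_j`, a linear Schrödinger-type equation
with potential `U = i ∑ ∂_x g_k` (`linear_problem`, `linear_problem_shift`).

Nonlinearity enters by expressing `U` through the `φ_j`. The partial fractions of `1/f` and `f(u_k)
= f(v_k)` give `1 + ∑_j q_j / ((α_k - E_j)(β_k - E_j)) = 0` (`reduction`), and then `U = ∑_j q_j
(φ_j φ_j⁻ - 1)`, with `φ_j⁻` the oppositely shifted ratio (`potential_eq`). Conjugation exchanges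
the `α` with the `β`, so `φ_j⁻` is the conjugate of `φ_j` (`conj_det_cauchyM`). Since `q_j = s_j
|q_j|`, the potential is `∑ s_j |ψ_j|²` up to the constant `∑ q_j`, which the exponential factor of
`ψ_j` absorbs. -/

namespace NBreather

open Complex Matrix

/-! ### Algebra of Cauchy-like matrices. -/

section CauchyMatrix

variable {ι : Type*} [Fintype ι] [DecidableEq ι]

/-- The Cauchy-like matrix with entries `(α_i - β_i) / (α_k - β_i) * e_i`. -/
noncomputable def cauchyM (α β e : ι → ℂ) : Matrix ι ι ℂ :=
  Matrix.of fun i k => (α i - β i) / (α k - β i) * e i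

omit [Fintype ι] [DecidableEq ι] in
theorem cauchyM_mul_sub {α β : ι → ℂ} (hαβ : ∀ i k, α k ≠ β i) (e : ι → ℂ) (i k : ι) :
    cauchyM α β e i k * (α k - β i) = (α i - β i) * e i := by
  have := sub_ne_zero.2 (hαβ i k)
  simp only [cauchyM, Matrix.of_apply]
  field_simp

theorem det_one_add_vecMulVec (x y : ι → ℂ) :
    (1 + vecMulVec x y).det = 1 + ∑ k, y k * x k := by
  rw [vecMulVec_eq Unit, det_one_add_replicateCol_mul_replicateRow]
  rfl

/-- Since `β_i - E = (α_k - E) - (α_k - β_i)` and the last term cancels the Cauchy denominator,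
conjugating by `diag(α - E)` makes the shifted matrix differ from `1 + M` by the rank-one matrix `m
⊗ (α - E)⁻¹`. As `m = (1 + M) g`, the factor `1 + M` splits off. -/
theorem det_one_add_cauchyM_shift {α β : ι → ℂ} (hαβ : ∀ i k, α k ≠ β i) {E : ℂ}
    (hα : ∀ k, α k ≠ E) (e g : ι → ℂ)
    (hg : (1 + cauchyM α β e) *ᵥ g = fun i => (α i - β i) * e i) :
    (1 + cauchyM α β fun i => (β i - E) / (α i - E) * e i).det
      = (1 + cauchyM α β e).det * (1 - ∑ k, g k / (α k - E)) := by
  have hα' : ∀ k, α k - E ≠ 0 := fun k => sub_ne_zero.2 (hα k)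
  have key : diagonal (fun i => α i - E) * (1 + cauchyM α β fun i => (β i - E) / (α i - E) * e i)
      = (1 + cauchyM α β e) * (1 + vecMulVec g fun k => -(α k - E)⁻¹)
        * diagonal (fun i => α i - E) := by
    rw [mul_add (1 + cauchyM α β e), mul_vecMulVec, hg, add_mul, vecMulVec_mul]
    ext i k
    have h1 := cauchyM_mul_sub hαβ e i k
    have h2 := sub_ne_zero.2 (hαβ i k)
    have h3 := hα' i
    have h4 := hα' k
    have h5 : (-(α k - E)⁻¹) * (α k - E) = -1 := by field_simp
    simp only [diagonal_mul, mul_diagonal, Matrix.add_apply, vecMulVec_apply, vecMul_diagonal, h5,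
      mul_one, cauchyM, Matrix.of_apply, Matrix.one_apply]
    split_ifs with hik
    · subst hik
      field_simp
      ring
    · field_simp
      ring
  have hdet := congrArg Matrix.det key
  rw [det_mul, det_mul, det_mul, det_one_add_vecMulVec, det_diagonal] at hdet
  have hprod : ∏ i, (α i - E) ≠ 0 := Finset.prod_ne_zero_iff.2 fun i _ => hα' i
  apply mul_left_cancel₀ hprod
  rw [hdet]
  have : ∑ k, -(α k - E)⁻¹ * g k = -∑ k, g k / (α k - E) := by
    rw [← Finset.sum_neg_distrib]
    exact Finset.sum_congr rfl fun k _ => by ring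
  rw [this]
  ring

/-- The mirror image: the rank-one correction now has the constant row `1 = l (1 + M)`, so `1 + M`
splits off on the right. -/
theorem det_one_add_cauchyM_shift_inv {α β : ι → ℂ} (hαβ : ∀ i k, α k ≠ β i) {E : ℂ}
    (hα : ∀ k, α k ≠ E) (hβ : ∀ k, β k ≠ E) (e l : ι → ℂ)
    (hl : l ᵥ* (1 + cauchyM α β e) = fun _ => 1) :
    (1 + cauchyM α β fun i => ((β i - E) / (α i - E))⁻¹ * e i).det
      = (1 + cauchyM α β e).det * (1 + ∑ k, l k * ((α k - β k) * e k / (β k - E))) := by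
  have hα' : ∀ k, α k - E ≠ 0 := fun k => sub_ne_zero.2 (hα k)
  have hβ' : ∀ k, β k - E ≠ 0 := fun k => sub_ne_zero.2 (hβ k)
  have key : (1 + cauchyM α β fun i => ((β i - E) / (α i - E))⁻¹ * e i)
        * diagonal (fun i => α i - E)
      = diagonal (fun i => α i - E)
        * ((1 + vecMulVec (fun k => (α k - β k) * e k / (β k - E)) l) * (1 + cauchyM α β e)) := by
    rw [add_mul _ _ (1 + cauchyM α β e), vecMulVec_mul, hl]
    ext i k
    have h2 := sub_ne_zero.2 (hαβ i k)
    have h3 := hα' i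
    have h4 := hβ' i
    simp only [diagonal_mul, mul_diagonal, Matrix.add_apply, vecMulVec_apply, one_mul,
      mul_one, cauchyM, Matrix.of_apply, Matrix.one_apply]
    split_ifs with hik
    · subst hik
      field_simp
      ring
    · field_simp
      ring
  have hdet := congrArg Matrix.det key
  rw [det_mul, det_mul, det_mul, det_one_add_vecMulVec, det_diagonal] at hdet
  have hprod : ∏ i, (α i - E) ≠ 0 := Finset.prod_ne_zero_iff.2 fun i _ => hα' i
  apply mul_right_cancel₀ hprod
  rw [hdet]
  ring

/-- The product `φ₊ φ₋` of the two shifted determinant ratios. -/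
theorem shift_mul_shift_inv {α β : ι → ℂ} (hαβ : ∀ i k, α k ≠ β i) {E : ℂ}
    (hα : ∀ k, α k ≠ E) (hβ : ∀ k, β k ≠ E) (e g l : ι → ℂ)
    (hg : (1 + cauchyM α β e) *ᵥ g = fun i => (α i - β i) * e i)
    (hl : l ᵥ* (1 + cauchyM α β e) = fun _ => 1) :
    (1 - ∑ k, g k / (α k - E)) * (1 + ∑ k, l k * ((α k - β k) * e k / (β k - E))) - 1
      = ∑ k, l k * g k * ((α k - β k) / ((α k - E) * (β k - E))) := by
  have hα' : ∀ k, α k - E ≠ 0 := fun k => sub_ne_zero.2 (hα k)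
  have hβ' : ∀ k, β k - E ≠ 0 := fun k => sub_ne_zero.2 (hβ k)
  have hg' : ∀ i, ∑ k, cauchyM α β e i k * g k = (α i - β i) * e i - g i := by
    intro i
    have := congrFun hg i
    rw [add_mulVec, one_mulVec] at this
    rw [← this]
    simp [mulVec, dotProduct]
  have hl' : ∀ k, ∑ i, l i * cauchyM α β e i k = 1 - l k := by
    intro k
    have := congrFun hl k
    rw [vecMul_add, vecMul_one] at this
    rw [← this]
    simp [vecMul, dotProduct]
  -- Inserting `m_i = M_ik (α_k - β_i)` splits the double sum by `(α_k - β_i) / ((α_k - E)(β_i - E))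
  -- = 1/(β_i - E) - 1/(α_k - E)`; the systems for `g` and `l` then carry out one summation in each
  -- part.
  have hcross : (∑ k, g k / (α k - E)) * (∑ k, l k * ((α k - β k) * e k / (β k - E)))
      = ∑ i, l i * ((α i - β i) * e i - g i) / (β i - E) - ∑ k, (1 - l k) * g k / (α k - E) := by
    simp_rw [← hg', ← hl']
    rw [mul_comm, Finset.sum_mul_sum]
    simp_rw [Finset.mul_sum, Finset.sum_mul, Finset.sum_div]
    rw [Finset.sum_comm (f := fun k i => l i * cauchyM α β e i k * g k / (α k - E)),
      ← Finset.sum_sub_distrib]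
    refine Finset.sum_congr rfl fun i _ => ?_
    rw [← Finset.sum_sub_distrib]
    refine Finset.sum_congr rfl fun k _ => ?_
    rw [← cauchyM_mul_sub hαβ e i k]
    have := hα' k
    have := hβ' i
    field_simp
    ring
  have expand : (1 - ∑ k, g k / (α k - E)) * (1 + ∑ k, l k * ((α k - β k) * e k / (β k - E))) - 1
      = ∑ k, l k * ((α k - β k) * e k / (β k - E)) - ∑ k, g k / (α k - E)
        - (∑ k, g k / (α k - E)) * (∑ k, l k * ((α k - β k) * e k / (β k - E))) := by ring
  rw [expand, hcross, ← Finset.sum_sub_distrib, ← Finset.sum_sub_distrib, ← Finset.sum_sub_distrib]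
  refine Finset.sum_congr rfl fun k _ => ?_
  have := hα' k
  have := hβ' k
  field_simp
  ring

/-- The second-order linear equation satisfied by the solution vector `g` of `(1 + M) g = m`. -/
theorem linear_problem {α β : ι → ℂ} (hαβ : ∀ i k, α k ≠ β i) (e g gx gxx gt : ι → ℂ)
    (hdet : (1 + cauchyM α β e).det ≠ 0)
    (hg : (1 + cauchyM α β e) *ᵥ g = fun i => (α i - β i) * e i)
    (hx : (1 + cauchyM α β e) *ᵥ gx = fun i => I * (α i - β i) * g i)
    (ht : (1 + cauchyM α β e) *ᵥ gt = fun i => I * (α i ^ 2 - β i ^ 2) * g i)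
    (hxx : (1 + cauchyM α β e) *ᵥ gxx
      = fun i => 2 * I * (α i - β i) * gx i + (α i - β i) ^ 2 * g i) (i : ι) :
    I * gt i + gxx i - 2 * I * α i * gx i + 2 * (I * ∑ k, gx k) * g i = 0 := by
  set M := cauchyM α β e with hM
  -- Moving `α` through `M` turns it into `β` and leaves the rank-one term `m ∑ gx`, which is the
  -- source of the potential.
  have hA : ((1 + M) *ᵥ fun i => α i * gx i) = fun i => β i * (I * (α i - β i) * g i)
      + (α i - β i) * gx i + (α i - β i) * e i * ∑ k, gx k := by
    ext i
    have h1 := congrFun hx i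
    rw [add_mulVec, one_mulVec] at h1 ⊢
    simp only [Pi.add_apply, mulVec, dotProduct] at h1 ⊢
    have h2 : ∑ k, M i k * (α k * gx k)
        = β i * ∑ k, M i k * gx k + (α i - β i) * e i * ∑ k, gx k := by
      rw [Finset.mul_sum, Finset.mul_sum, ← Finset.sum_add_distrib]
      refine Finset.sum_congr rfl fun k _ => ?_
      rw [← cauchyM_mul_sub hαβ e i k]
      ring
    rw [h2, ← h1]
    ring
  have hzero : (1 + M) *ᵥ (I • gt + gxx - (2 * I) • (fun i => α i * gx i)
      + (2 * (I * ∑ k, gx k)) • g) = 0 := by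
    rw [mulVec_add, mulVec_sub, mulVec_add, mulVec_smul, mulVec_smul, mulVec_smul, hg, ht, hxx, hA]
    ext i
    simp only [Pi.add_apply, Pi.sub_apply, Pi.smul_apply, smul_eq_mul, Pi.zero_apply]
    linear_combination (-(α i ^ 2 - β i ^ 2) * g i * (-1) - 2 * β i * (α i - β i) * g i) * I_sq
  have := Matrix.eq_zero_of_mulVec_eq_zero hdet hzero
  have h := congrFun this i
  simp only [Pi.add_apply, Pi.sub_apply, Pi.smul_apply, smul_eq_mul, Pi.zero_apply] at h
  rw [← h]
  ring

omit [DecidableEq ι] in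
/-- The linear equation for the shifted determinant ratio `φ = 1 - ∑ g_k / (α_k - E)`. -/
theorem linear_problem_shift {α : ι → ℂ} {E : ℂ} (hα : ∀ k, α k ≠ E) (g gx gxx gt : ι → ℂ)
    (h : ∀ i, I * gt i + gxx i - 2 * I * α i * gx i + 2 * (I * ∑ k, gx k) * g i = 0) :
    I * (-∑ k, gt k / (α k - E)) + (-∑ k, gxx k / (α k - E))
      - 2 * I * E * (-∑ k, gx k / (α k - E))
      + 2 * (I * ∑ k, gx k) * (1 - ∑ k, g k / (α k - E)) = 0 := by
  have hα' : ∀ k, α k - E ≠ 0 := fun k => sub_ne_zero.2 (hα k)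
  have h0 : ∑ k, (I * gt k + gxx k - 2 * I * α k * gx k + 2 * (I * ∑ k, gx k) * g k)
      / (α k - E) = 0 := Finset.sum_eq_zero fun k _ => by rw [h, zero_div]
  have h1 : ∑ k, (I * gt k + gxx k - 2 * I * α k * gx k + 2 * (I * ∑ k, gx k) * g k) / (α k - E)
      = I * (∑ k, gt k / (α k - E)) + (∑ k, gxx k / (α k - E))
        - 2 * I * E * (∑ k, gx k / (α k - E)) - 2 * I * (∑ k, gx k)
        + 2 * (I * ∑ k, gx k) * (∑ k, g k / (α k - E)) := by
    -- Protects the potential from the rewriting of sums. The term `∑ gx` on the right comes from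
    -- `α_k / (α_k - E) = 1 + E / (α_k - E)`.
    generalize 2 * (I * ∑ k, gx k) = S
    simp_rw [Finset.mul_sum, ← Finset.sum_add_distrib, ← Finset.sum_sub_distrib,
      ← Finset.sum_add_distrib]
    refine Finset.sum_congr rfl fun k _ => ?_
    have := hα' k
    field_simp
    ring
  linear_combination (-1) * h0 + h1

/-- Under the reduction condition the potential is the sum of the products `φ₊ φ₋ - 1`. -/
theorem potential_eq {n : ℕ} {α β : ι → ℂ} (hαβ : ∀ i k, α k ≠ β i) (q E : Fin n → ℂ)
    (hα : ∀ j k, α k ≠ E j) (hβ : ∀ j k, β k ≠ E j)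
    (hred : ∀ k, 1 + ∑ j, q j / ((α k - E j) * (β k - E j)) = 0) (e g gx l : ι → ℂ)
    (hg : (1 + cauchyM α β e) *ᵥ g = fun i => (α i - β i) * e i)
    (hl : l ᵥ* (1 + cauchyM α β e) = fun _ => 1)
    (hx : (1 + cauchyM α β e) *ᵥ gx = fun i => I * (α i - β i) * g i) :
    I * ∑ k, gx k = ∑ j, q j * ((1 - ∑ k, g k / (α k - E j))
      * (1 + ∑ k, l k * ((α k - β k) * e k / (β k - E j))) - 1) := by
  simp_rw [fun j => shift_mul_shift_inv hαβ (hα j) (hβ j) e g l hg hl, Finset.mul_sum]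
  rw [Finset.sum_comm, ← Finset.mul_sum]
  -- Pairing with `l` inverts `1 + M`, because `l (1 + M)` is the constant row `1`.
  have hs : ∑ k, gx k = l ⬝ᵥ fun i => I * (α i - β i) * g i := by
    rw [← hx, dotProduct_mulVec, hl]
    simp [dotProduct]
  rw [hs, dotProduct, Finset.mul_sum]
  refine Finset.sum_congr rfl fun k _ => ?_
  have : ∑ j, q j * (l k * g k * ((α k - β k) / ((α k - E j) * (β k - E j))))
      = l k * g k * (α k - β k) * ∑ j, q j / ((α k - E j) * (β k - E j)) := by
    rw [Finset.mul_sum]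
    refine Finset.sum_congr rfl fun j _ => ?_
    ring
  rw [this]
  linear_combination (-(l k * g k * (α k - β k))) * hred k
    + l k * g k * (α k - β k) * I_sq

/-- Complex conjugation of the determinants, under an involutive pairing of the parameters. -/
theorem conj_det_cauchyM (σ : Equiv.Perm ι) {α β : ι → ℂ} (hne : ∀ k, α k ≠ β k)
    (hα : ∀ k, (starRingEnd ℂ) (α k) = β (σ k)) (hβ : ∀ k, (starRingEnd ℂ) (β k) = α (σ k))
    {e e' : ι → ℂ} (he : ∀ k, (starRingEnd ℂ) (e k) = e' (σ k)) (he' : ∀ k, e' k ≠ 0) :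
    (starRingEnd ℂ) (1 + cauchyM α β e).det = (1 + cauchyM α β e').det := by
  have h1 : (starRingEnd ℂ) (1 + cauchyM α β e).det
      = ((1 + Matrix.of fun i k => (β i - α i) / (β k - α i) * e' i).submatrix σ σ).det := by
    rw [RingHom.map_det]
    congr 1
    ext i k
    simp [cauchyM, Matrix.one_apply, hα, hβ, he, apply_ite (starRingEnd ℂ)]
  rw [h1, det_submatrix_equiv_self, ← det_transpose]
  have hw : ∀ k, (α k - β k) * e' k ≠ 0 := fun k => mul_ne_zero (sub_ne_zero.2 (hne k)) (he' k)
  -- After conjugation and reindexing, `α` and `β` are interchanged; transposition followed by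
  -- conjugation with `diag(m)` undoes this.
  have h2 : diagonal (fun k => (α k - β k) * e' k)
        * (1 + Matrix.of fun i k => (β i - α i) / (β k - α i) * e' i)ᵀ
      = (1 + cauchyM α β e') * diagonal (fun k => (α k - β k) * e' k) := by
    ext i k
    simp only [diagonal_mul, mul_diagonal, transpose_apply, Matrix.add_apply, Matrix.of_apply,
      Matrix.one_apply, cauchyM]
    rw [← neg_sub (α k) (β k), ← neg_sub (α k) (β i), neg_div_neg_eq]
    by_cases hik : i = k
    · subst hik
      simp
      ring
    · rw [if_neg hik, if_neg (Ne.symm hik)]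
      ring
  have hdet := congrArg Matrix.det h2
  rw [det_mul, det_mul, det_diagonal, mul_comm] at hdet
  exact mul_right_cancel₀ (Finset.prod_ne_zero_iff.2 fun k _ => hw k) hdet

end CauchyMatrix

end NBreather

namespace NBreather

open Complex

/-! ### Partial fractions and reality of `f`. -/

section RationalFunction

variable {m : ℕ} {a b : Fin m → ℂ}

theorem hasDerivAt_merFun_zero (hab : ∀ i k, a i ≠ b k) (i : Fin m) :
    HasDerivAt (merFun a b) (1 / (a i - b i) * ∏ k ∈ Finset.univ.erase i,
      (a i - a k) / (a i - b k)) (a i) := by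
  have hsplit : merFun a b = fun w => (w - a i) / (w - b i)
      * ∏ k ∈ Finset.univ.erase i, (w - a k) / (w - b k) := by
    funext w
    rw [merFun, Finset.mul_prod_erase Finset.univ (fun k => (w - a k) / (w - b k))
      (Finset.mem_univ i)]
  have hd : DifferentiableAt ℂ
      (fun w => ∏ k ∈ Finset.univ.erase i, (w - a k) / (w - b k)) (a i) := by
    refine DifferentiableAt.fun_finsetProd fun k _ => ?_
    exact (differentiableAt_id.sub_const _).div (differentiableAt_id.sub_const _)
      (sub_ne_zero.2 (hab i k))
  have h1 : HasDerivAt (fun w => (w - a i) / (w - b i)) (1 / (a i - b i)) (a i) := by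
    have h0 := sub_ne_zero.2 (hab i i)
    refine (((hasDerivAt_id' (a i)).sub_const (a i)).fun_div
      ((hasDerivAt_id' (a i)).sub_const (b i)) h0).congr_deriv ?_
    field_simp
    ring
  rw [hsplit]
  refine (h1.fun_mul hd.hasDerivAt).congr_deriv ?_
  rw [sub_self, zero_div, zero_mul, add_zero]

theorem deriv_merFun_zero (hab : ∀ i k, a i ≠ b k) (i : Fin m) :
    deriv (merFun a b) (a i)
      = (∏ k ∈ Finset.univ.erase i, (a i - a k)) / ∏ k, (a i - b k) := by
  rw [(hasDerivAt_merFun_zero hab i).deriv, Finset.prod_div_distrib,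
    ← Finset.mul_prod_erase Finset.univ (fun k => a i - b k) (Finset.mem_univ i)]
  rw [div_mul_div_comm, one_mul]

theorem deriv_merFun_zero_ne (ha : Function.Injective a) (hab : ∀ i k, a i ≠ b k) (i : Fin m) :
    deriv (merFun a b) (a i) ≠ 0 := by
  rw [deriv_merFun_zero hab]
  refine div_ne_zero (Finset.prod_ne_zero_iff.2 fun k hk => ?_)
    (Finset.prod_ne_zero_iff.2 fun k _ => sub_ne_zero.2 (hab i k))
  exact sub_ne_zero.2 fun h => (Finset.ne_of_mem_erase hk) (ha h).symm

/-- Partial fraction decomposition of `1 / f`. -/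
theorem inv_merFun (ha : Function.Injective a) (hab : ∀ i k, a i ≠ b k) {w : ℂ}
    (hw : ∀ i, w ≠ a i) :
    (∏ i, (w - b i)) / ∏ i, (w - a i)
      = 1 + ∑ i, 1 / (deriv (merFun a b) (a i) * (w - a i)) := by
  open Polynomial in
  -- Both nodal polynomials are monic of degree `m`, so their difference is recovered by Lagrange
  -- interpolation at the `a_i`.
  set P : Polynomial ℂ := Lagrange.nodal Finset.univ b - Lagrange.nodal Finset.univ a with hP
  have hdeg : P.degree < (Finset.univ : Finset (Fin m)).card := by
    have := Polynomial.degree_sub_lt_left (p := Lagrange.nodal Finset.univ b)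
      (q := Lagrange.nodal Finset.univ a) (by simp [Lagrange.degree_nodal])
      Lagrange.nodal_ne_zero (by rw [Lagrange.nodal_monic.leadingCoeff,
        Lagrange.nodal_monic.leadingCoeff])
    rwa [Lagrange.degree_nodal] at this
  have hinterp := Lagrange.eq_interpolate (v := a) (s := Finset.univ) ha.injOn hdeg
  have hev := congrArg (Polynomial.eval w) hinterp
  rw [Lagrange.eval_interpolate_not_at_node _ fun i _ => hw i, hP, Polynomial.eval_sub,
    Lagrange.eval_nodal, Lagrange.eval_nodal] at hev
  have hA : ∏ i, (w - a i) ≠ 0 := Finset.prod_ne_zero_iff.2 fun i _ => sub_ne_zero.2 (hw i)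
  have hsum : ∑ i, Lagrange.nodalWeight Finset.univ a i * (w - a i)⁻¹
        * Polynomial.eval (a i) (Lagrange.nodal Finset.univ b - Lagrange.nodal Finset.univ a)
      = ∑ i, 1 / (deriv (merFun a b) (a i) * (w - a i)) := by
    refine Finset.sum_congr rfl fun i _ => ?_
    rw [deriv_merFun_zero hab, Polynomial.eval_sub, Lagrange.eval_nodal_at_node (Finset.mem_univ i),
      Lagrange.eval_nodal, sub_zero, Lagrange.nodalWeight, Finset.prod_inv_distrib,
      one_div, mul_inv, inv_div]
    ring
  rw [hsum] at hev
  rw [div_eq_iff hA]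
  linear_combination hev

/-- Comparing `1/f` instead of `f` treats poles uniformly: the value infinity becomes `0`. The
difference of the two partial fraction expansions has the factor `v - u`, which can be cancelled. -/
theorem sum_eq_zero_of_sphereValue_eq (ha : Function.Injective a) (hab : ∀ i k, a i ≠ b k)
    {u v : ℂ} (hu : ∀ i, u ≠ a i) (hv : ∀ i, v ≠ a i) (huv : u ≠ v)
    (h : sphereValue a b u = sphereValue a b v) :
    ∑ i, 1 / (deriv (merFun a b) (a i) * ((u - a i) * (v - a i))) = 0 := by
  have hinv : (∏ i, (u - b i)) / ∏ i, (u - a i) = (∏ i, (v - b i)) / ∏ i, (v - a i) := by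
    unfold sphereValue at h
    split_ifs at h with h1 h2 h2
    · obtain ⟨i, hi⟩ := h1
      obtain ⟨k, hk⟩ := h2
      have hu0 : ∏ i, (u - b i) = 0 := Finset.prod_eq_zero (Finset.mem_univ i) (sub_eq_zero.2 hi)
      have hv0 : ∏ i, (v - b i) = 0 := Finset.prod_eq_zero (Finset.mem_univ k) (sub_eq_zero.2 hk)
      rw [hu0, hv0, zero_div, zero_div]
    · exact absurd h (OnePoint.infty_ne_coe _)
    · exact absurd h (OnePoint.coe_ne_infty _)
    · have h3 := OnePoint.coe_injective h
      rw [merFun, merFun, Finset.prod_div_distrib, Finset.prod_div_distrib] at h3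
      rw [← inv_div, h3, inv_div]
  rw [inv_merFun ha hab hu, inv_merFun ha hab hv] at hinv
  have hd : ∑ i, 1 / (deriv (merFun a b) (a i) * (u - a i))
      - ∑ i, 1 / (deriv (merFun a b) (a i) * (v - a i))
      = (v - u) * ∑ i, 1 / (deriv (merFun a b) (a i) * ((u - a i) * (v - a i))) := by
    rw [← Finset.sum_sub_distrib, Finset.mul_sum]
    refine Finset.sum_congr rfl fun i _ => ?_
    have h1 := sub_ne_zero.2 (hu i)
    have h2 := sub_ne_zero.2 (hv i)
    have h3 := deriv_merFun_zero_ne ha hab i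
    field_simp
    ring
  have : (v - u) * ∑ i, 1 / (deriv (merFun a b) (a i) * ((u - a i) * (v - a i))) = 0 := by
    rw [← hd]
    linear_combination hinv
  exact (mul_eq_zero.1 this).resolve_left (sub_ne_zero.2 huv.symm)

theorem merFun_conj (ha : ∀ i, (a i).im = 0)
    (hb : ∃ σ : Equiv.Perm (Fin m), ∀ i, (starRingEnd ℂ) (b i) = b (σ i)) :
    starRingEnd ℂ ∘ merFun a b ∘ starRingEnd ℂ = merFun a b := by
  obtain ⟨σ, hσ⟩ := hb
  funext w
  simp only [Function.comp, merFun, map_prod, map_div₀, map_sub, conj_conj, hσ,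
    fun i => conj_eq_iff_im.2 (ha i), Finset.prod_div_distrib]
  rw [Equiv.prod_comp σ fun i => w - b i]

/-- The conclusion has the shape of the hypothesis, so a second application reaches `f''`. -/
theorem deriv_conj_fixed {f : ℂ → ℂ} (hf : starRingEnd ℂ ∘ f ∘ starRingEnd ℂ = f) :
    starRingEnd ℂ ∘ deriv f ∘ starRingEnd ℂ = deriv f := by
  rw [← deriv_conj_conj, hf]

theorem conj_apply_of_fixed {f : ℂ → ℂ} (hf : starRingEnd ℂ ∘ f ∘ starRingEnd ℂ = f) {c : ℂ}
    (hc : c.im = 0) : (starRingEnd ℂ) (f c) = f c := by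
  conv_rhs => rw [← hf]
  simp [Function.comp, conj_eq_iff_im.2 hc]

theorem deriv_localParam (c : ℂ) : deriv (localParam a b c) = deriv (merFun a b) := by
  funext w
  exact deriv_sub_const _

theorem iteratedDeriv_two_localParam (c : ℂ) :
    iteratedDeriv 2 (localParam a b c) = deriv (deriv (merFun a b)) := by
  rw [iteratedDeriv_succ, iteratedDeriv_one, deriv_localParam]

end RationalFunction

end NBreather

namespace NBreather

open Complex Matrix Topology

/-! ### Smooth dependence of determinants and inverses. -/

section Smoothness

variable {ι X : Type*} [Fintype ι] [DecidableEq ι] [NormedAddCommGroup X] [NormedSpace ℝ X]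

theorem contDiff_det {A : X → Matrix ι ι ℂ} (hA : ∀ i k, ContDiff ℝ (⊤ : ℕ∞) fun p => A p i k) :
    ContDiff ℝ (⊤ : ℕ∞) fun p => (A p).det := by
  simp_rw [det_apply']
  exact ContDiff.sum fun σ _ => contDiff_const.mul (contDiff_prod fun i _ => hA _ _)

theorem contDiff_adjugate {A : X → Matrix ι ι ℂ}
    (hA : ∀ i k, ContDiff ℝ (⊤ : ℕ∞) fun p => A p i k) (i k : ι) :
    ContDiff ℝ (⊤ : ℕ∞) fun p => (A p).adjugate i k := by
  simp_rw [adjugate_apply]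
  refine contDiff_det fun i' k' => ?_
  by_cases h : i' = k
  · subst h
    simp only [updateRow_self]
    exact contDiff_const
  · simp only [updateRow_ne h]
    exact hA i' k'

theorem contDiffAt_inv_mulVec {A : X → Matrix ι ι ℂ} {r : X → ι → ℂ}
    (hA : ∀ i k, ContDiff ℝ (⊤ : ℕ∞) fun p => A p i k)
    (hr : ∀ i, ContDiff ℝ (⊤ : ℕ∞) fun p => r p i) {p₀ : X} (h : (A p₀).det ≠ 0) (i : ι) :
    ContDiffAt ℝ (⊤ : ℕ∞) (fun p => ((A p)⁻¹ *ᵥ r p) i) p₀ := by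
  have heq : (fun p => ((A p)⁻¹ *ᵥ r p) i)
      = fun p => (A p).det⁻¹ * ∑ k, (A p).adjugate i k * r p k := by
    funext p
    rw [Matrix.inv_def, Ring.inverse_eq_inv', smul_mulVec, Pi.smul_apply, smul_eq_mul]
    rfl
  rw [heq]
  refine ((contDiff_det hA).contDiffAt.inv h).mul (ContDiff.contDiffAt ?_)
  exact ContDiff.sum fun k _ => (contDiff_adjugate hA i k).mul (hr k)

end Smoothness

/-! ### Evolution in `x` and `t`. -/

section Evolution

variable {ι : Type*} [Fintype ι] [DecidableEq ι]

/-- Only the row factors `e_i` depend on `s`, so `M' = diag(iμ) M` and `M' g = iμ (r - g)`. Each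
derivative of `g` thus solves the same linear system with an explicit right-hand side. -/
theorem cauchyM_mulVec_deriv {α β μ : ι → ℂ} {e g r : ℝ → ι → ℂ} {g' r' : ι → ℂ} {s₀ : ℝ}
    (he : ∀ k, HasDerivAt (fun s => e s k) (I * μ k * e s₀ k) s₀)
    (hg : ∀ k, HasDerivAt (fun s => g s k) (g' k) s₀)
    (hr : ∀ k, HasDerivAt (fun s => r s k) (r' k) s₀)
    (h : ∀ᶠ s in 𝓝 s₀, (1 + cauchyM α β (e s)) *ᵥ g s = r s) :
    (1 + cauchyM α β (e s₀)) *ᵥ g' = fun i => r' i - I * μ i * (r s₀ i - g s₀ i) := by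
  have expand : ∀ (M : Matrix ι ι ℂ) (w : ι → ℂ) (i : ι),
      ((1 + M) *ᵥ w) i = w i + ∑ k, M i k * w k := by
    intro M w i
    rw [add_mulVec, one_mulVec]
    rfl
  ext i
  have h0 := congrFun h.self_of_nhds i
  have hd : HasDerivAt (fun s => g s i + ∑ k, cauchyM α β (e s) i k * g s k)
      (g' i + ∑ k, ((α i - β i) / (α k - β i) * (I * μ i * e s₀ i) * g s₀ k
        + cauchyM α β (e s₀) i k * g' k)) s₀ := by
    refine (hg i).add (HasDerivAt.fun_sum fun k _ => ?_)
    exact ((he i).const_mul _).fun_mul (hg k)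
  have heq : (fun s => g s i + ∑ k, cauchyM α β (e s) i k * g s k) =ᶠ[𝓝 s₀] fun s => r s i := by
    filter_upwards [h] with s hs
    rw [← expand, hs]
  have huniq := hd.unique ((hr i).congr_of_eventuallyEq heq)
  rw [expand] at h0 ⊢
  rw [← huniq, ← h0, Finset.sum_add_distrib]
  have : ∑ k, (α i - β i) / (α k - β i) * (I * μ i * e s₀ i) * g s₀ k
      = I * μ i * ∑ k, cauchyM α β (e s₀) i k * g s₀ k := by
    rw [Finset.mul_sum]
    refine Finset.sum_congr rfl fun k _ => ?_
    simp only [cauchyM, Matrix.of_apply]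
    ring
  rw [this]
  ring

/-- The exponentials `exp (i (α_k - β_k) x + i (α_k² - β_k²) t - d_k)`. -/
noncomputable def expPhase (α β d : ι → ℂ) (x t : ℝ) (k : ι) : ℂ :=
  exp (I * (α k - β k) * x + I * (α k ^ 2 - β k ^ 2) * t - d k)

/-- The solution `g` of `(1 + M) g = m`. -/
noncomputable def solVec (α β d : ι → ℂ) (x t : ℝ) : ι → ℂ :=
  (1 + cauchyM α β (expPhase α β d x t))⁻¹ *ᵥ fun i => (α i - β i) * expPhase α β d x t i

variable {α β d : ι → ℂ}

omit [Fintype ι] [DecidableEq ι] in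
theorem contDiff_expPhase (k : ι) :
    ContDiff ℝ (⊤ : ℕ∞) fun p : ℝ × ℝ => expPhase α β d p.1 p.2 k := by
  have h1 : ContDiff ℝ (⊤ : ℕ∞) fun p : ℝ × ℝ => (p.1 : ℂ) := ofRealCLM.contDiff.comp contDiff_fst
  have h2 : ContDiff ℝ (⊤ : ℕ∞) fun p : ℝ × ℝ => (p.2 : ℂ) := ofRealCLM.contDiff.comp contDiff_snd
  exact (((contDiff_const.mul h1).add (contDiff_const.mul h2)).sub contDiff_const).cexp

omit [Fintype ι] in
theorem contDiff_one_add_cauchyM (δ : ι → ℂ) (i k : ι) :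
    ContDiff ℝ (⊤ : ℕ∞) fun p : ℝ × ℝ =>
      (1 + cauchyM α β fun j => δ j * expPhase α β d p.1 p.2 j) i k := by
  simp only [Matrix.add_apply, cauchyM, Matrix.of_apply]
  exact contDiff_const.add (contDiff_const.mul (contDiff_const.mul (contDiff_expPhase i)))

theorem contDiff_det_shift (δ : ι → ℂ) :
    ContDiff ℝ (⊤ : ℕ∞) fun p : ℝ × ℝ =>
      (1 + cauchyM α β fun j => δ j * expPhase α β d p.1 p.2 j).det :=
  contDiff_det fun i k => contDiff_one_add_cauchyM δ i k

theorem contDiff_det_expPhase :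
    ContDiff ℝ (⊤ : ℕ∞) fun p : ℝ × ℝ => (1 + cauchyM α β (expPhase α β d p.1 p.2)).det := by
  simpa using contDiff_det_shift (α := α) (β := β) (d := d) fun _ => 1

theorem contDiffAt_solVec {x t : ℝ} (h : (1 + cauchyM α β (expPhase α β d x t)).det ≠ 0) (k : ι) :
    ContDiffAt ℝ (⊤ : ℕ∞) (fun p : ℝ × ℝ => solVec α β d p.1 p.2 k) (x, t) := by
  have hA : ∀ i k, ContDiff ℝ (⊤ : ℕ∞) fun p : ℝ × ℝ =>
      (1 + cauchyM α β (expPhase α β d p.1 p.2)) i k := by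
    intro i k
    have := contDiff_one_add_cauchyM (α := α) (β := β) (d := d) (fun _ => 1) i k
    simp only [one_mul] at this
    exact this
  have hr : ∀ i, ContDiff ℝ (⊤ : ℕ∞) fun p : ℝ × ℝ =>
      (α i - β i) * expPhase α β d p.1 p.2 i := fun i =>
    contDiff_const.mul (contDiff_expPhase i)
  exact contDiffAt_inv_mulVec (A := fun p : ℝ × ℝ => 1 + cauchyM α β (expPhase α β d p.1 p.2))
    (r := fun p i => (α i - β i) * expPhase α β d p.1 p.2 i) (p₀ := (x, t)) hA hr h k

omit [Fintype ι] [DecidableEq ι] in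
theorem hasDerivAt_expPhase_x (x t : ℝ) (k : ι) :
    HasDerivAt (fun ξ => expPhase α β d ξ t k) (I * (α k - β k) * expPhase α β d x t k) x := by
  unfold expPhase
  have h := (((hasDerivAt_id x).ofReal_comp.const_mul (I * (α k - β k))).add_const
    (I * (α k ^ 2 - β k ^ 2) * t)).sub_const (d k)
  refine h.cexp.congr_deriv ?_
  simp
  ring

omit [Fintype ι] [DecidableEq ι] in
theorem hasDerivAt_expPhase_t (x t : ℝ) (k : ι) :
    HasDerivAt (fun τ => expPhase α β d x τ k) (I * (α k ^ 2 - β k ^ 2) * expPhase α β d x t k)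
      t := by
  unfold expPhase
  have h := (((hasDerivAt_id t).ofReal_comp.const_mul (I * (α k ^ 2 - β k ^ 2))).const_add
    (I * (α k - β k) * x)).sub_const (d k)
  refine h.cexp.congr_deriv ?_
  simp
  ring

theorem mulVec_solVec {x t : ℝ} (h : (1 + cauchyM α β (expPhase α β d x t)).det ≠ 0) :
    (1 + cauchyM α β (expPhase α β d x t)) *ᵥ solVec α β d x t
      = fun i => (α i - β i) * expPhase α β d x t i := by
  rw [solVec, mulVec_mulVec, Matrix.mul_nonsing_inv _ (isUnit_iff_ne_zero.2 h), one_mulVec]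

/-- The multi-component equation for the shifted determinant ratios. -/
theorem nls_of_reduction {n : ℕ} (hαβ : ∀ i k, α k ≠ β i) {q E : Fin n → ℂ}
    (hα : ∀ j k, α k ≠ E j) (hβ : ∀ j k, β k ≠ E j)
    (hred : ∀ k, 1 + ∑ j, q j / ((α k - E j) * (β k - E j)) = 0) {x t : ℝ}
    (h : (1 + cauchyM α β (expPhase α β d x t)).det ≠ 0) (j : Fin n) (C : ℂ)
    {ψ : ℝ → ℝ → ℂ} (hψ : ∀ x t, ψ x t = C *
      ((1 + cauchyM α β fun i => (β i - E j) / (α i - E j) * expPhase α β d x t i).det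
        / (1 + cauchyM α β (expPhase α β d x t)).det)
      * exp (I * (-(E j) * x + (-(E j) ^ 2 + 2 * ∑ k, q k) * t))) :
    I * deriv (fun τ => ψ x τ) t + iteratedDeriv 2 (fun ξ => ψ ξ t) x
      + 2 * (∑ k, q k *
        ((1 + cauchyM α β fun i => (β i - E k) / (α i - E k) * expPhase α β d x t i).det
          / (1 + cauchyM α β (expPhase α β d x t)).det
        * ((1 + cauchyM α β fun i =>
            ((β i - E k) / (α i - E k))⁻¹ * expPhase α β d x t i).det
          / (1 + cauchyM α β (expPhase α β d x t)).det))) * ψ x t = 0 := by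
  set D : ℝ → ℝ → ℂ := fun x t => (1 + cauchyM α β (expPhase α β d x t)).det with hD
  have hratio : ∀ x t, D x t ≠ 0 → ∀ k,
      (1 + cauchyM α β fun i => (β i - E k) / (α i - E k) * expPhase α β d x t i).det / D x t
        = 1 - ∑ i, solVec α β d x t i / (α i - E k) := by
    intro x t hxt k
    rw [det_one_add_cauchyM_shift hαβ (hα k) _ _ (mulVec_solVec hxt), mul_div_cancel_left₀ _ hxt]
  have hcontD : Continuous fun p : ℝ × ℝ => D p.1 p.2 := contDiff_det_expPhase.continuous
  have hopenx : IsOpen {ξ : ℝ | D ξ t ≠ 0} :=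
    isOpen_ne.preimage (hcontD.comp (Continuous.prodMk_left t))
  have hopent : IsOpen {τ : ℝ | D x τ ≠ 0} :=
    isOpen_ne.preimage (hcontD.comp (Continuous.prodMk_right x))
  -- derivatives of `g`
  have hgx : ∀ k, ContDiffOn ℝ (⊤ : ℕ∞) (fun ξ => solVec α β d ξ t k) {ξ : ℝ | D ξ t ≠ 0} :=
    fun k ξ hξ => ((contDiffAt_solVec hξ k).comp ξ
      (contDiffAt_id.prodMk contDiffAt_const)).contDiffWithinAt
  have hgt : ContDiffAt ℝ (⊤ : ℕ∞) (fun τ => fun k => solVec α β d x τ k) t :=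
    contDiffAt_pi.2 fun k => (contDiffAt_solVec h k).comp t (contDiffAt_const.prodMk contDiffAt_id)
  -- Kept as a function of `ξ`, since its linear system is differentiated once more to reach `gxx`.
  set gx : ℝ → ι → ℂ := fun ξ k => deriv (fun ξ => solVec α β d ξ t k) ξ with hgx_def
  set gxx : ι → ℂ := fun k => deriv (fun ξ => gx ξ k) x with hgxx_def
  set gt : ι → ℂ := fun k => deriv (fun τ => solVec α β d x τ k) t with hgt_def
  have dgx : ∀ ξ, D ξ t ≠ 0 → ∀ k,
      HasDerivAt (fun ξ => solVec α β d ξ t k) (gx ξ k) ξ := fun ξ hξ k =>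
    (((hgx k).contDiffAt (hopenx.mem_nhds hξ)).differentiableAt (by simp)).hasDerivAt
  have dgxx : ∀ k, HasDerivAt (fun ξ => gx ξ k) (gxx k) x := fun k =>
    ((((hgx k).deriv_of_isOpen (m := (⊤ : ℕ∞)) hopenx (by simp)).contDiffAt
      (hopenx.mem_nhds h)).differentiableAt (by simp)).hasDerivAt
  have dgt : ∀ k, HasDerivAt (fun τ => solVec α β d x τ k) (gt k) t := fun k =>
    ((contDiffAt_pi.1 hgt k).differentiableAt (by simp)).hasDerivAt
  -- linear relations
  have rg := mulVec_solVec h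
  have rx : ∀ ξ, D ξ t ≠ 0 → (1 + cauchyM α β (expPhase α β d ξ t)) *ᵥ gx ξ
      = fun i => I * (α i - β i) * solVec α β d ξ t i := by
    intro ξ hξ
    rw [cauchyM_mulVec_deriv (μ := fun k => α k - β k) (hasDerivAt_expPhase_x ξ t) (dgx ξ hξ)
      (fun k => (hasDerivAt_expPhase_x ξ t k).const_mul (α k - β k))
      (by filter_upwards [hopenx.mem_nhds hξ] with s hs using mulVec_solVec hs)]
    ext i
    ring
  have rt : (1 + cauchyM α β (expPhase α β d x t)) *ᵥ gt
      = fun i => I * (α i ^ 2 - β i ^ 2) * solVec α β d x t i := by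
    rw [cauchyM_mulVec_deriv (μ := fun k => α k ^ 2 - β k ^ 2) (hasDerivAt_expPhase_t x t) dgt
      (fun k => (hasDerivAt_expPhase_t x t k).const_mul (α k - β k))
      (by filter_upwards [hopent.mem_nhds h] with s hs using mulVec_solVec hs)]
    ext i
    ring
  have rxx : (1 + cauchyM α β (expPhase α β d x t)) *ᵥ gxx
      = fun i => 2 * I * (α i - β i) * gx x i + (α i - β i) ^ 2 * solVec α β d x t i := by
    rw [cauchyM_mulVec_deriv (μ := fun k => α k - β k) (hasDerivAt_expPhase_x x t) dgxx
      (fun k => (dgx x h k).const_mul (I * (α k - β k)))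
      (by filter_upwards [hopenx.mem_nhds h] with s hs using rx s hs)]
    ext i
    linear_combination (-(α i - β i) ^ 2 * solVec α β d x t i) * I_sq
  -- the potential
  set l : ι → ℂ := (fun _ => 1) ᵥ* (1 + cauchyM α β (expPhase α β d x t))⁻¹ with hl_def
  have hl : l ᵥ* (1 + cauchyM α β (expPhase α β d x t)) = fun _ => 1 := by
    rw [hl_def, vecMul_vecMul, Matrix.nonsing_inv_mul _ (isUnit_iff_ne_zero.2 h), vecMul_one]
  have hpot := potential_eq hαβ q E hα hβ hred _ _ _ _ rg hl (rx x h)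
  have hlin := linear_problem_shift (hα j) _ _ _ _
    (linear_problem hαβ _ _ _ _ _ h rg (rx x h) rt rxx)
  have hpot' : ∑ k, q k *
        ((1 + cauchyM α β fun i => (β i - E k) / (α i - E k) * expPhase α β d x t i).det / D x t
        * ((1 + cauchyM α β fun i =>
            ((β i - E k) / (α i - E k))⁻¹ * expPhase α β d x t i).det / D x t))
      = I * (∑ k, gx x k) + ∑ k, q k := by
    rw [hpot, ← Finset.sum_add_distrib]
    refine Finset.sum_congr rfl fun k _ => ?_
    rw [hratio x t h k, det_one_add_cauchyM_shift_inv hαβ (hα k) (hβ k) _ _ hl,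
      mul_div_cancel_left₀ _ h]
    ring
  rw [hpot']
  -- derivatives of `ψ`
  set φ : ℝ → ℝ → ℂ := fun x t => 1 - ∑ i, solVec α β d x t i / (α i - E j) with hφ
  set F : ℂ := -(E j) ^ 2 + 2 * ∑ k, q k with hF
  set ex : ℝ → ℝ → ℂ := fun x t => exp (I * (-(E j) * x + F * t)) with hex
  have hψ' : ∀ x t, D x t ≠ 0 → ψ x t = C * φ x t * ex x t := by
    intro x t hxt
    rw [hψ, hratio x t hxt j]
  have dex_x : ∀ ξ, HasDerivAt (fun ξ => ex ξ t) (-(I * E j) * ex ξ t) ξ := by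
    intro ξ
    refine (((((hasDerivAt_id ξ).ofReal_comp.const_mul (-(E j))).add_const (F * t)).const_mul
      I).cexp).congr_deriv ?_
    simp [hex]
    ring
  have dex_t : HasDerivAt (fun τ => ex x τ) (I * F * ex x t) t := by
    refine (((((hasDerivAt_id t).ofReal_comp.const_mul F).const_add (-(E j) * x)).const_mul
      I).cexp).congr_deriv ?_
    simp [hex]
    ring
  have dφx : ∀ ξ, D ξ t ≠ 0 →
      HasDerivAt (fun ξ => φ ξ t) (-∑ k, gx ξ k / (α k - E j)) ξ := fun ξ hξ =>
    (HasDerivAt.fun_sum fun k _ => (dgx ξ hξ k).div_const (α k - E j)).const_sub 1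
  have dφxx : HasDerivAt (fun ξ => -∑ k, gx ξ k / (α k - E j))
      (-∑ k, gxx k / (α k - E j)) x :=
    (HasDerivAt.fun_sum fun k _ => (dgxx k).div_const (α k - E j)).fun_neg
  have dφt : HasDerivAt (fun τ => φ x τ) (-∑ k, gt k / (α k - E j)) t :=
    (HasDerivAt.fun_sum fun k _ => (dgt k).div_const (α k - E j)).const_sub 1
  have dψx : ∀ ξ, D ξ t ≠ 0 → HasDerivAt (fun ξ => ψ ξ t)
      (C * (-∑ k, gx ξ k / (α k - E j)) * ex ξ t + C * φ ξ t * (-(I * E j) * ex ξ t)) ξ := by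
    intro ξ hξ
    refine (((dφx ξ hξ).const_mul C).fun_mul (dex_x ξ)).congr_of_eventuallyEq ?_
    filter_upwards [hopenx.mem_nhds hξ] with s hs using hψ' s t hs
  have dψt : HasDerivAt (fun τ => ψ x τ)
      (C * (-∑ k, gt k / (α k - E j)) * ex x t + C * φ x t * (I * F * ex x t)) t := by
    refine ((dφt.const_mul C).fun_mul dex_t).congr_of_eventuallyEq ?_
    filter_upwards [hopent.mem_nhds h] with s hs using hψ' x s hs
  have dψxx : HasDerivAt (deriv fun ξ => ψ ξ t)
      (C * (-∑ k, gxx k / (α k - E j)) * ex x t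
        + C * (-∑ k, gx x k / (α k - E j)) * (-(I * E j) * ex x t)
        + (C * (-∑ k, gx x k / (α k - E j)) * (-(I * E j) * ex x t)
        + C * φ x t * (-(I * E j) * (-(I * E j) * ex x t)))) x := by
    refine (((dφxx.const_mul C).fun_mul (dex_x x)).fun_add
      (((dφx x h).const_mul C).fun_mul ((dex_x x).const_mul (-(I * E j))))).congr_of_eventuallyEq ?_
    filter_upwards [hopenx.mem_nhds h] with s hs using (dψx s hs).deriv
  rw [iteratedDeriv_succ, iteratedDeriv_one, dψt.deriv, dψxx.deriv, hψ' x t h]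
  have hI : I ^ 2 = -1 := I_sq
  rw [hF]
  -- The exponential removes the first-order term `-2iE ∂_x φ`; in its frequency, `-E²` cancels what
  -- the second derivative produces and `2 ∑ q` compensates for the constant in `hpot'`.
  linear_combination (C * ex x t) * hlin
    + (C * φ x t * ex x t * (-(E j) ^ 2 + 2 * ∑ k, q k + E j ^ 2)) * hI

end Evolution

end NBreather

namespace NBreather

open Complex Matrix

/-! ### The coordinate `K` and the determinants. -/

section SpectralParameter

theorem coefV_eq (κ : ℂ → ℂ) (c u v : ℂ) : coefV κ c u v = coefK κ c u - coefK κ c v := by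
  unfold coefV coefK
  rw [← neg_sub u c, ← neg_sub v c]
  simp only [one_div, mul_inv, inv_neg]
  ring

theorem coefW_eq (κ : ℂ → ℂ) (c u v : ℂ) :
    coefW κ c u v = coefK κ c u ^ 2 - coefK κ c v ^ 2 := by
  unfold coefW
  rw [coefV_eq]
  unfold coefK
  rw [← neg_sub u c, ← neg_sub v c]
  simp only [div_eq_mul_inv, mul_inv, neg_sq, ← inv_pow]
  ring

theorem coefK_sub {κ : ℂ → ℂ} {c : ℂ} (hκ : deriv κ c ≠ 0) {u v : ℂ} (hu : u ≠ c) (hv : v ≠ c) :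
    coefK κ c u - coefK κ c v = (v - u) / (deriv κ c * ((u - c) * (v - c))) := by
  have := sub_ne_zero.2 hu
  have := sub_ne_zero.2 hv
  unfold coefK
  field_simp
  ring

theorem coefK_ne {κ : ℂ → ℂ} {c : ℂ} (hκ : deriv κ c ≠ 0) {u v : ℂ} (hu : u ≠ c) (hv : v ≠ c)
    (huv : u ≠ v) : coefK κ c u ≠ coefK κ c v := by
  rw [← sub_ne_zero, coefK_sub hκ hu hv]
  exact div_ne_zero (sub_ne_zero.2 huv.symm)
    (mul_ne_zero hκ (mul_ne_zero (sub_ne_zero.2 hu) (sub_ne_zero.2 hv)))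

/-- The argument of the logarithm is a cross-ratio of `e`, `c`, `u`, `v`, hence invariant under `K`;
as `K` sends `c` to infinity, only two differences remain. -/
theorem exp_coefR {κ : ℂ → ℂ} {c : ℂ} (hκ : deriv κ c ≠ 0) {e u v : ℂ} (he : e ≠ c) (hu : u ≠ c)
    (hv : v ≠ c) (hue : u ≠ e) (hve : v ≠ e) :
    exp (coefR c e u v) = (coefK κ c v - coefK κ c e) / (coefK κ c u - coefK κ c e) := by
  have h1 := sub_ne_zero.2 he
  have h2 := sub_ne_zero.2 hu
  have h3 := sub_ne_zero.2 hv
  have h4 := sub_ne_zero.2 hue.symm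
  have h5 := sub_ne_zero.2 hve.symm
  have h6 := sub_ne_zero.2 hu.symm
  have h7 := sub_ne_zero.2 hv.symm
  rw [coefR, exp_log (mul_ne_zero (div_ne_zero h5 h4) (div_ne_zero h6 h7)), coefK_sub hκ hv he,
    coefK_sub hκ hu he]
  field_simp
  ring

/-- Conjugation by `exp(z_k/2) / (u_k - c)`: the exponential gathers the symmetric factor into the
row, and the denominator accounts for the change of coordinate in the Cauchy quotient. -/
theorem det_matT {g : ℕ} {κ : ℂ → ℂ} {c : ℂ} (hκ : deriv κ c ≠ 0) {u v : Fin g → ℂ}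
    (hu : ∀ k, u k ≠ c) (hv : ∀ k, v k ≠ c) (hvu : ∀ i k, v i ≠ u k) (z : Fin g → ℂ) :
    (matT u v z).det = (1 + cauchyM (fun k => coefK κ c (u k)) (fun k => coefK κ c (v k))
      fun k => exp (z k)).det := by
  have hu' : ∀ k, u k - c ≠ 0 := fun k => sub_ne_zero.2 (hu k)
  have hv' : ∀ k, v k - c ≠ 0 := fun k => sub_ne_zero.2 (hv k)
  set w : Fin g → ℂ := fun k => exp (1 / 2 * z k) / (u k - c) with hw_def
  have hw : ∀ k, w k ≠ 0 := fun k => div_ne_zero (exp_ne_zero _) (hu' k)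
  have h : diagonal w * matT u v z = (1 + cauchyM (fun k => coefK κ c (u k))
      (fun k => coefK κ c (v k)) fun k => exp (z k)) * diagonal w := by
    ext i k
    have h1 : exp (z i) = exp (1 / 2 * z i) * exp (1 / 2 * z i) := by
      rw [← exp_add]
      congr 1
      ring
    have h2 : exp (1 / 2 * (z i + z k)) = exp (1 / 2 * z i) * exp (1 / 2 * z k) := by
      rw [← exp_add, mul_add]
    have h3 := sub_ne_zero.2 (hvu i k)
    have h4 := hu' i
    have h5 := hu' k
    have h6 := hv' i
    simp only [diagonal_mul, mul_diagonal, Matrix.add_apply, matT, cauchyM, Matrix.of_apply,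
      Matrix.one_apply, h1, h2, hw_def, coefK_sub hκ (hu i) (hv i), coefK_sub hκ (hu k) (hv i)]
    split_ifs with hik
    · subst hik
      field_simp
    · field_simp
      ring
  have hdet := congrArg Matrix.det h
  rw [det_mul, det_mul, det_diagonal, mul_comm] at hdet
  exact mul_right_cancel₀ (Finset.prod_ne_zero_iff.2 fun k _ => hw k) hdet

theorem conj_coefK {κ : ℂ → ℂ} {c : ℂ} (hc : c.im = 0)
    (h1 : (starRingEnd ℂ) (deriv κ c) = deriv κ c)
    (h2 : (starRingEnd ℂ) (iteratedDeriv 2 κ c) = iteratedDeriv 2 κ c) (w : ℂ) :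
    (starRingEnd ℂ) (coefK κ c w) = coefK κ c ((starRingEnd ℂ) w) := by
  simp only [coefK, map_sub, map_div₀, map_mul, map_one, map_pow, h1, h2, conj_eq_iff_im.2 hc,
    map_ofNat]

end SpectralParameter

/-! ### The conjugation pairing of indices. -/

section Pairing

/-- The involution of `Fin (2 * N)` that swaps `oddIdx k` and `evenIdx k`. -/
def pairSwap (N : ℕ) : Equiv.Perm (Fin (2 * N)) :=
  Function.Involutive.toPerm
    (fun k => if h : (k : ℕ) % 2 = 0 then ⟨k + 1, by omega⟩ else ⟨k - 1, by omega⟩) (by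
      intro k
      ext
      by_cases h : (k : ℕ) % 2 = 0
      · have h' : ¬ ((k : ℕ) + 1) % 2 = 0 := by omega
        simp [h, h']
      · have h' : ((k : ℕ) - 1) % 2 = 0 := by omega
        simp only [h, h', dite_true, dite_false]
        omega)

theorem pairSwap_oddIdx {N : ℕ} (k : Fin N) : pairSwap N (oddIdx k) = evenIdx k := by
  have : (2 * (k : ℕ)) % 2 = 0 := by omega
  exact dif_pos this

theorem pairSwap_evenIdx {N : ℕ} (k : Fin N) : pairSwap N (evenIdx k) = oddIdx k := by
  have : ¬ (2 * (k : ℕ) + 1) % 2 = 0 := by omega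
  exact dif_neg this

theorem forall_pair {N : ℕ} {P : Fin (2 * N) → Prop} (ho : ∀ k, P (oddIdx k))
    (he : ∀ k, P (evenIdx k)) (k : Fin (2 * N)) : P k := by
  rcases Nat.even_or_odd' (k : ℕ) with ⟨m, hm | hm⟩
  · have : k = oddIdx ⟨m, by omega⟩ := Fin.ext hm
    exact this ▸ ho _
  · have : k = evenIdx ⟨m, by omega⟩ := Fin.ext hm
    exact this ▸ he _

theorem conj_pair {N : ℕ} {u v : Fin (2 * N) → ℂ}
    (he : ∀ k : Fin N, (starRingEnd ℂ) (u (evenIdx k)) = v (oddIdx k))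
    (ho : ∀ k : Fin N, (starRingEnd ℂ) (u (oddIdx k)) = v (evenIdx k)) (k : Fin (2 * N)) :
    (starRingEnd ℂ) (u k) = v (pairSwap N k) :=
  forall_pair (P := fun k => (starRingEnd ℂ) (u k) = v (pairSwap N k))
    (fun k => by rw [pairSwap_oddIdx, ho]) (fun k => by rw [pairSwap_evenIdx, he]) k

theorem conj_expPhase {ι : Type*} {α β d : ι → ℂ} (σ : Equiv.Perm ι)
    (hα : ∀ k, (starRingEnd ℂ) (α k) = β (σ k)) (hβ : ∀ k, (starRingEnd ℂ) (β k) = α (σ k))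
    (hd : ∀ k, (starRingEnd ℂ) (d k) = d (σ k)) (x t : ℝ) (k : ι) :
    (starRingEnd ℂ) (expPhase α β d x t k) = expPhase α β d x t (σ k) := by
  rw [expPhase, expPhase, ← exp_conj]
  simp only [map_sub, map_add, map_mul, map_pow, conj_I, conj_ofReal, hα, hβ, hd]
  congr 1
  ring

end Pairing

theorem sign_mul_norm_inv {r s : ℝ} :
    ((Real.sign r : ℝ) : ℂ) * ‖(1 / (r * (s : ℂ) ^ 2) : ℂ)‖ = 1 / (r * (s : ℂ) ^ 2) := by
  rw [norm_div, norm_one, norm_mul, norm_pow, norm_real, norm_real, Real.norm_eq_abs,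
    Real.norm_eq_abs, sq_abs]
  norm_cast
  rcases lt_trichotomy r 0 with h | h | h
  · rw [Real.sign_of_neg h, abs_of_neg h, neg_mul, one_mul, neg_mul, one_div, one_div, inv_neg,
      neg_neg]
  · simp [h]
  · rw [Real.sign_of_pos h, abs_of_pos h, one_mul]

/-! ### Signs, the reduction condition and moduli. -/

section Solution

variable {n : ℕ} {a b : Fin (n + 1) → ℂ}

/-- At the real simple zeros `f'` is real and nonzero, and `(c - a_j)²` is positive, so `q_j` is
real with the sign of `f'(c) f'(a_j)`. -/
theorem signS_eq (ha_real : ∀ i, (a i).im = 0) (ha : Function.Injective a)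
    (hab : ∀ i k, a i ≠ b k)
    (hb : ∃ σ : Equiv.Perm (Fin (n + 1)), ∀ i, (starRingEnd ℂ) (b i) = b (σ i)) (j : Fin n) :
    (signS a b j = 1 ∨ signS a b j = -1) ∧ (signS a b j : ℂ) * ‖q2 a b j‖ = q2 a b j := by
  have hfix := deriv_conj_fixed (merFun_conj ha_real hb)
  have hreal : ∀ i, ((deriv (merFun a b) (a i)).re : ℂ) = deriv (merFun a b) (a i) := fun i =>
    conj_eq_iff_re.1 (conj_apply_of_fixed hfix (ha_real i))
  have hreal' : ∀ i, ((a i).re : ℂ) = a i := fun i =>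
    conj_eq_iff_re.1 (conj_eq_iff_im.2 (ha_real i))
  have hre : (deriv (merFun a b) (a (Fin.last n)) * deriv (merFun a b) (a j.castSucc)).re
      = (deriv (merFun a b) (a (Fin.last n))).re * (deriv (merFun a b) (a j.castSucc)).re := by
    rw [← hreal, ← hreal j.castSucc, ← ofReal_mul, ofReal_re, ofReal_re, ofReal_re]
  have hne : ∀ i, (deriv (merFun a b) (a i)).re ≠ 0 := fun i h =>
    deriv_merFun_zero_ne ha hab i (by rw [← hreal, h, ofReal_zero])
  constructor
  · rw [signS, hre]
    exact (Real.sign_apply_eq_of_ne_zero _ (mul_ne_zero (hne _) (hne _))).symm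
  · have hq : q2 a b j = 1 / (((deriv (merFun a b) (a (Fin.last n))).re
        * (deriv (merFun a b) (a j.castSucc)).re : ℝ)
        * (((a (Fin.last n)).re - (a j.castSucc).re : ℝ) : ℂ) ^ 2) := by
      rw [q2, coefQ, deriv_localParam, deriv_localParam, ofReal_mul, ofReal_sub, hreal, hreal,
        hreal', hreal']
    rw [signS, hre, hq]
    exact sign_mul_norm_inv

/-- The vanishing partial fraction sum, multiplied by `f'(c)(u - c)(v - c)`: the term of `c` becomes
`1`, and the others become the quotients by the difference formula `coefK_sub`. -/
theorem reduction (ha : Function.Injective a) (hab : ∀ i k, a i ≠ b k) {u v : ℂ}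
    (hu : ∀ i, u ≠ a i) (hv : ∀ i, v ≠ a i) (huv : u ≠ v)
    (h : sphereValue a b u = sphereValue a b v) :
    1 + ∑ j, q2 a b j
      / ((coefK (localParam a b (a (Fin.last n))) (a (Fin.last n)) u - coefE a b j)
        * (coefK (localParam a b (a (Fin.last n))) (a (Fin.last n)) v - coefE a b j)) = 0 := by
  have hsum := sum_eq_zero_of_sphereValue_eq ha hab hu hv huv h
  have hκ : deriv (localParam a b (a (Fin.last n))) (a (Fin.last n)) ≠ 0 := by
    rw [deriv_localParam]
    exact deriv_merFun_zero_ne ha hab _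
  have h1 := sub_ne_zero.2 (hu (Fin.last n))
  have h2 := sub_ne_zero.2 (hv (Fin.last n))
  rw [Fin.sum_univ_castSucc] at hsum
  have hterm : ∀ j : Fin n, q2 a b j
      / ((coefK (localParam a b (a (Fin.last n))) (a (Fin.last n)) u - coefE a b j)
        * (coefK (localParam a b (a (Fin.last n))) (a (Fin.last n)) v - coefE a b j))
      = deriv (merFun a b) (a (Fin.last n)) * ((u - a (Fin.last n)) * (v - a (Fin.last n)))
        * (1 / (deriv (merFun a b) (a j.castSucc)
          * ((u - a j.castSucc) * (v - a j.castSucc)))) := by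
    intro j
    have hne : a j.castSucc ≠ a (Fin.last n) := fun h => (Fin.castSucc_lt_last j).ne (ha h)
    have h3 := sub_ne_zero.2 hne
    have h3' := sub_ne_zero.2 hne.symm
    have h4 := sub_ne_zero.2 (hu j.castSucc)
    have h5 := sub_ne_zero.2 (hv j.castSucc)
    have h4' := sub_ne_zero.2 (hu j.castSucc).symm
    have h5' := sub_ne_zero.2 (hv j.castSucc).symm
    have h6 := deriv_merFun_zero_ne ha hab j.castSucc
    have h7 := deriv_merFun_zero_ne ha hab (Fin.last n)
    rw [coefE, coefK_sub hκ (hu _) hne, coefK_sub hκ (hv _) hne, q2, coefQ, deriv_localParam,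
      deriv_localParam, ← neg_sub u (a j.castSucc), ← neg_sub v (a j.castSucc),
      ← neg_sub (a j.castSucc) (a (Fin.last n)), neg_sq]
    field_simp
  simp_rw [hterm]
  rw [← Finset.mul_sum]
  have h7 := deriv_merFun_zero_ne ha hab (Fin.last n)
  have hlast : deriv (merFun a b) (a (Fin.last n))
      * ((u - a (Fin.last n)) * (v - a (Fin.last n)))
      * (1 / (deriv (merFun a b) (a (Fin.last n))
        * ((u - a (Fin.last n)) * (v - a (Fin.last n))))) = 1 := by
    field_simp
  linear_combination (deriv (merFun a b) (a (Fin.last n))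
    * ((u - a (Fin.last n)) * (v - a (Fin.last n)))) * hsum - hlast

theorem ofReal_norm_sq_mul_exp {A θ y : ℝ} (z : ℂ) {w : ℂ} (hw : w = y) :
    ((‖(A : ℂ) * exp (I * θ) * z * exp (I * w)‖ : ℝ) : ℂ) ^ 2
      = (A : ℂ) ^ 2 * (z * (starRingEnd ℂ) z) := by
  have h1 : ∀ s : ℝ, ‖exp (I * s)‖ = 1 := fun s => by rw [mul_comm, norm_exp_ofReal_mul_I]
  rw [hw, norm_mul, norm_mul, norm_mul, h1, h1, mul_one, mul_one, mul_conj', ofReal_mul, mul_pow,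
    norm_real, ← ofReal_pow, Real.norm_eq_abs, sq_abs, ofReal_pow]

end Solution

end NBreather

/-! ### The breather solutions. -/

theorem mainTheorem4 (n N : ℕ) (hn : 1 ≤ n) (hN : 1 ≤ N)
    -- the zeros and poles of the real function `f`; all zeros are real and simple
    (a b : Fin (n + 1) → ℂ)
    (ha_real : ∀ i, (a i).im = 0)
    (ha_inj : Function.Injective a)
    (hab : ∀ i k, a i ≠ b k)
    (hb_real : ∃ σ : Equiv.Perm (Fin (n + 1)), ∀ i, (starRingEnd ℂ) (b i) = b (σ i))
    (θ : ℝ) (d u v : Fin (2 * N) → ℂ)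
    (hd : ∀ k : Fin N, (starRingEnd ℂ) (d (NBreather.oddIdx k)) = d (NBreather.evenIdx k))
    -- `f(w_{u_k}) = f(w_{v_k})` in the Riemann sphere, and the conjugation conditions
    (hf : ∀ k, NBreather.sphereValue a b (u k) = NBreather.sphereValue a b (v k))
    (huv_even : ∀ k : Fin N,
      (starRingEnd ℂ) (u (NBreather.evenIdx k)) = v (NBreather.oddIdx k))
    (huv_odd : ∀ k : Fin N,
      (starRingEnd ℂ) (u (NBreather.oddIdx k)) = v (NBreather.evenIdx k))
    -- the quantities in the formula are defined: no denominator vanishes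
    (hvu : ∀ i k, v i ≠ u k)
    (hua : ∀ k i, u k ≠ a i) (hva : ∀ k i, v k ≠ a i) :
    NBreather.IsNNLSSolutionOn (NBreather.signS a b) (NBreather.regularSet a b u v d)
      (NBreather.psi a b u v d θ) := by
  open NBreather Complex Matrix in
  set c := a (Fin.last n) with hc_def
  set κ := localParam a b c with hκ_def
  set α : Fin (2 * N) → ℂ := fun k => coefK κ c (u k) with hα_def
  set β : Fin (2 * N) → ℂ := fun k => coefK κ c (v k) with hβ_def
  have hκ : deriv κ c ≠ 0 := by
    rw [hκ_def, deriv_localParam]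
    exact deriv_merFun_zero_ne ha_inj hab _
  have hac : ∀ j : Fin n, a j.castSucc ≠ c := fun j h => (Fin.castSucc_lt_last j).ne (ha_inj h)
  have hαβ : ∀ i k, α k ≠ β i := fun i k => coefK_ne hκ (hua k _) (hva i _) (hvu i k).symm
  have hαE : ∀ j k, α k ≠ coefE a b j := fun j k => coefK_ne hκ (hua k _) (hac j) (hua k _)
  have hβE : ∀ j k, β k ≠ coefE a b j := fun j k => coefK_ne hκ (hva k _) (hac j) (hva k _)
  -- the determinants
  have hphase : ∀ x t k, exp (phaseZ a b u v x t k - d k) = expPhase α β d x t k := by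
    intro x t k
    rw [phaseZ, coefV_eq, coefW_eq, expPhase]
  have hτ0 : ∀ j x t,
      (matTj a b u v d j 0 x t).det = (1 + cauchyM α β (expPhase α β d x t)).det := by
    intro j x t
    rw [matTj, det_matT hκ (fun k => hua k _) (fun k => hva k _) hvu]
    simp only [zero_mul, add_zero, hphase]
    rfl
  have hτ1 : ∀ j x t, (matTj a b u v d j 1 x t).det
      = (1 + cauchyM α β fun i => (β i - coefE a b j) / (α i - coefE a b j)
        * expPhase α β d x t i).det := by
    intro j x t
    rw [matTj, det_matT hκ (fun k => hua k _) (fun k => hva k _) hvu]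
    congr 3
    funext k
    rw [one_mul, exp_add, hphase, exp_coefR hκ (hac j) (hua k _) (hva k _) (hua k _) (hva k _),
      mul_comm]
    rfl
  have hreg : regularSet a b u v d
      = {p : ℝ × ℝ | (1 + cauchyM α β (expPhase α β d p.1 p.2)).det ≠ 0} := by
    ext p
    simp only [regularSet, Set.mem_ofPred_eq, hτ0]
    -- With no index `j` the condition would be empty; `1 ≤ n` supplies one.
    exact ⟨fun h => h ⟨0, hn⟩, fun h _ => h⟩
  -- complex conjugation
  have hfix := merFun_conj ha_real hb_real
  have hκ1 : (starRingEnd ℂ) (deriv κ c) = deriv κ c := by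
    rw [hκ_def, deriv_localParam]
    exact conj_apply_of_fixed (deriv_conj_fixed hfix) (ha_real _)
  have hκ2 : (starRingEnd ℂ) (iteratedDeriv 2 κ c) = iteratedDeriv 2 κ c := by
    rw [hκ_def, iteratedDeriv_two_localParam]
    exact conj_apply_of_fixed (deriv_conj_fixed (deriv_conj_fixed hfix)) (ha_real _)
  have hu_conj := conj_pair huv_even huv_odd
  have hv_conj : ∀ k, (starRingEnd ℂ) (v k) = u (pairSwap N k) := conj_pair
    (fun k => by rw [← huv_odd, conj_conj]) (fun k => by rw [← huv_even, conj_conj])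
  have hd_conj : ∀ k, (starRingEnd ℂ) (d k) = d (pairSwap N k) := conj_pair
    (fun k => by rw [← hd, conj_conj]) hd
  have hα_conj : ∀ k, (starRingEnd ℂ) (α k) = β (pairSwap N k) := fun k => by
    rw [hα_def, hβ_def]
    exact (conj_coefK (ha_real _) hκ1 hκ2 _).trans (congrArg _ (hu_conj k))
  have hβ_conj : ∀ k, (starRingEnd ℂ) (β k) = α (pairSwap N k) := fun k => by
    rw [hα_def, hβ_def]
    exact (conj_coefK (ha_real _) hκ1 hκ2 _).trans (congrArg _ (hv_conj k))
  have hE_conj : ∀ j, (starRingEnd ℂ) (coefE a b j) = coefE a b j := fun j => by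
    rw [coefE, conj_coefK (ha_real _) hκ1 hκ2, conj_eq_iff_im.2 (ha_real _)]
  have he_conj := conj_expPhase (pairSwap N) hα_conj hβ_conj hd_conj
  have hτ0_conj : ∀ x t, (starRingEnd ℂ) (1 + cauchyM α β (expPhase α β d x t)).det
      = (1 + cauchyM α β (expPhase α β d x t)).det := fun x t =>
    conj_det_cauchyM (pairSwap N) (fun k => hαβ k k) hα_conj hβ_conj (he_conj x t)
      fun k => exp_ne_zero _
  -- As `E_j` is real, conjugation exchanges numerator and denominator of the shift factor, up to
  -- the pairing, and so inverts it.
  have hτ1_conj : ∀ j x t, (starRingEnd ℂ)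
      (1 + cauchyM α β fun i => (β i - coefE a b j) / (α i - coefE a b j)
        * expPhase α β d x t i).det
      = (1 + cauchyM α β fun i => ((β i - coefE a b j) / (α i - coefE a b j))⁻¹
        * expPhase α β d x t i).det := fun j x t =>
    conj_det_cauchyM (pairSwap N) (fun k => hαβ k k) hα_conj hβ_conj
      (fun k => by
        rw [map_mul, map_div₀, map_sub, map_sub, hα_conj, hβ_conj, hE_conj, he_conj, inv_div])
      fun k => mul_ne_zero (inv_ne_zero (div_ne_zero (sub_ne_zero.2 (hβE j k))
        (sub_ne_zero.2 (hαE j k)))) (exp_ne_zero _)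
  have hsign := signS_eq ha_real ha_inj hab hb_real
  have hq_conj : ∀ j, (starRingEnd ℂ) (q2 a b j) = q2 a b j := fun j => by
    rw [← (hsign j).2, map_mul, conj_ofReal, conj_ofReal]
  have hpsi : ∀ j x t, psi a b u v d θ j x t
      = (Real.sqrt ‖q2 a b j‖ : ℂ) * exp (I * θ)
        * ((1 + cauchyM α β fun i => (β i - coefE a b j) / (α i - coefE a b j)
            * expPhase α β d x t i).det / (1 + cauchyM α β (expPhase α β d x t)).det)
        * exp (I * (-(coefE a b j) * x + (-(coefE a b j) ^ 2 + 2 * ∑ k, q2 a b k) * t)) := by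
    intro j x t
    rw [psi, hτ0, hτ1, coefF]
  have hnorm : ∀ j x t, (signS a b j : ℂ) * ((‖psi a b u v d θ j x t‖ : ℂ)) ^ 2
      = q2 a b j * ((1 + cauchyM α β fun i => (β i - coefE a b j) / (α i - coefE a b j)
            * expPhase α β d x t i).det / (1 + cauchyM α β (expPhase α β d x t)).det
        * ((1 + cauchyM α β fun i => ((β i - coefE a b j) / (α i - coefE a b j))⁻¹
            * expPhase α β d x t i).det / (1 + cauchyM α β (expPhase α β d x t)).det)) := by
    intro j x t
    -- The phase is real, so its exponential drops out of the modulus.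
    have hw : (starRingEnd ℂ)
        (-(coefE a b j) * x + (-(coefE a b j) ^ 2 + 2 * ∑ k, q2 a b k) * t)
        = -(coefE a b j) * x + (-(coefE a b j) ^ 2 + 2 * ∑ k, q2 a b k) * t := by
      simp only [map_add, map_mul, map_neg, map_pow, map_sum, hE_conj, hq_conj, conj_ofReal,
        map_ofNat]
    rw [hpsi, ofReal_norm_sq_mul_exp _ (conj_eq_iff_re.1 hw).symm, ← ofReal_pow,
      Real.sq_sqrt (norm_nonneg _), ← mul_assoc, (hsign j).2, map_div₀, hτ0_conj, hτ1_conj]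
  have hopen : IsOpen (regularSet a b u v d) := by
    rw [hreg]
    exact isOpen_ne.preimage contDiff_det_expPhase.continuous
  refine ⟨fun k => (hsign k).1, hopen, fun j => ?_, fun j x t hxt => ?_⟩
  · simp only [hpsi]
    rw [hreg]
    have h1 : ContDiff ℝ (⊤ : ℕ∞) fun p : ℝ × ℝ => (p.1 : ℂ) :=
      ofRealCLM.contDiff.comp contDiff_fst
    have h2 : ContDiff ℝ (⊤ : ℕ∞) fun p : ℝ × ℝ => (p.2 : ℂ) :=
      ofRealCLM.contDiff.comp contDiff_snd
    intro p hp
    have hne : (1 + cauchyM α β (expPhase α β d p.1 p.2)).det ≠ 0 := hp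
    have hτ := (contDiff_det_shift (α := α) (β := β) (d := d)
      fun i => (β i - coefE a b j) / (α i - coefE a b j)).contDiffAt (x := p)
    have hτ' := (contDiff_det_expPhase (α := α) (β := β) (d := d)).contDiffAt (x := p)
    simp only [div_eq_mul_inv _ (Matrix.det _)]
    refine ((contDiffAt_const.mul (hτ.mul (hτ'.inv hne))).mul
      (ContDiff.contDiffAt ?_)).contDiffWithinAt
    exact (contDiff_const.mul ((contDiff_const.mul h1).add (contDiff_const.mul h2))).cexp
  · rw [hreg] at hxt
    simp only [hnorm]
    exact nls_of_reduction hαβ hαE hβE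
      (fun k => reduction ha_inj hab (hua k) (hva k) (hvu k k).symm (hf k)) hxt j _ (hpsi j)
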